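/- Throughout, all topological spaces are completely regular and Hausdorff. Write $\mathsf{Top}$ for the category of completely regular Hausdorff spaces and continuous maps, $\mathsf{Cpt}\subset\mathsf{Top}$ for the full subcategory of compact Hausdorff spaces, and $\mathsf{RCpt}\subset\mathsf{Top}$ for the full subcategory of realcompact spaces, i.e. of those spaces that admit a closed embedding into $\mathbb{R}^{\kappa}$ for some cardinal $\kappa$. For a full subcategory $\mathsf{P}\subset\mathsf{Top}$, a space $X$ is called functorially $\mathsf{P}$-ifiable if there exist a space $N\in\mathsf{P}$ and a continuous map $i:X\to N$ such that for every $Y\in\mathsf{P}$ and every continuous map $f:X\to Y$ there is a unique continuous map $\tilde f:N\to Y$ with $f=\tilde f\circ i$. Write $\mathsf{P}^{\nu}\subset\mathsf{Top}$ for the full subcategory of functorially $\mathsf{P}$-ifiable spaces. Let $\mathsf{P}\subset\mathsf{Top}$ be a full subcategory that is closed under homeomorphism (a topological property), such that $\mathsf{Cpt}\subset\mathsf{P}$ and $\mathbb{R}\in\mathsf{P}\subset\mathsf{RCpt}$. Then $$\mathsf{P}^{\nu}\cap\mathsf{RCpt}=\mathsf{P}.$$ -/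

import Mathlib

open CategoryTheory Topology

universe u

/-- The property of being completely regular and Hausdorff. -/
def tychonoffProperty : ObjectProperty TopCat.{u} := fun X => T35Space X

/-- The category of completely regular Hausdorff spaces and continuous maps. Its full
subcategories are given by `ObjectProperty Tych`. -/
abbrev Tych : Type (u + 1) := tychonoffProperty.{u}.FullSubcategory

/-- A completely regular Hausdorff space as an object of `Tych`. -/
def Tych.of (X : Type u) [TopologicalSpace X] [T35Space X] : Tych.{u} :=
  ⟨TopCat.of X, ‹T35Space X›⟩

/-- The full subcategory of compact Hausdorff spaces. -/
def Cpt : ObjectProperty Tych.{u} := fun X => CompactSpace X.obj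

/-- The full subcategory of realcompact spaces: those admitting a closed embedding into a
power of the real line. -/
def RCpt : ObjectProperty Tych.{u} := fun X =>
  ∃ (κ : Type u) (e : X.obj → κ → ℝ), IsClosedEmbedding e

/-- The real line, lifted to the universe `u`. -/
def realLine : Tych.{u} :=
  haveI : T35Space (ULift.{u} ℝ) := IsEmbedding.uliftDown.t35Space
  Tych.of (ULift.{u} ℝ)

/-- The continuous map `i : X → N` is a functorial `P`-ification of `X`: the space `N` belongs
to `P`, and every continuous map from `X` to a member of `P` factors uniquely through `i`. -/
structure IsFunctorialPification (P : ObjectProperty Tych.{u}) (X N : Tych.{u})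
    (i : C(X.obj, N.obj)) : Prop where
  mem : P N
  existsUnique_extension : ∀ (Y : Tych.{u}), P Y → ∀ f : C(X.obj, Y.obj),
    ∃! g : C(N.obj, Y.obj), f = g.comp i

/-- The full subcategory of the functorially `P`-ifiable spaces, i.e. of those that admit a
functorial `P`-ification. -/
def FunctoriallyIfiable (P : ObjectProperty Tych.{u}) : ObjectProperty Tych.{u} := fun X =>
  ∃ (N : Tych.{u}) (i : C(X.obj, N.obj)), IsFunctorialPification P X N i

/-! Since `P` contains the line, uniqueness of extensions forces `i : X → N` to have dense range,
and existence, used coordinatewise, extends a closed embedding `e : X → ℝ^κ` to `g` on `N`. By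
density `g` stays in the closed set `e(X)`, so `e⁻¹ ∘ g` is defined on `N`; it inverts `i`, again by
density. Hence `X ≅ N` lies in `P`. -/

/-- The map to a functorial `P`-ification has dense range as soon as `P` contains the line. -/
theorem IsFunctorialPification.denseRange {P : ObjectProperty Tych.{u}} (hReal : P realLine)
    {X N : Tych.{u}} {i : C(X.obj, N.obj)} (h : IsFunctorialPification P X N i) :
    DenseRange i := by
  intro n
  by_contra hn
  have : T35Space N.obj := N.property
  -- Here `f` is 0 at `n` and 1 on the closure of the image, so `f` and the constant 1 both extend
  -- the constant 1 on `X`.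
  obtain ⟨f, hf, hfn, hfK⟩ := CompletelyRegularSpace.completely_regular n _
    (isClosed_closure (s := Set.range i)) hn
  let F : C(N.obj, realLine.{u}.obj) :=
    ⟨fun x => (ULift.up (f x : ℝ) : ULift.{u} ℝ),
      continuous_uliftUp.comp (continuous_subtype_val.comp hf)⟩
  let G : C(N.obj, realLine.{u}.obj) :=
    ⟨fun _ => (ULift.up 1 : ULift.{u} ℝ), continuous_const⟩
  have hFG : F.comp i = G.comp i := by
    ext x
    have hx : f (i x) = 1 := hfK (subset_closure ⟨x, rfl⟩)
    change (ULift.up (f (i x) : ℝ) : ULift.{u} ℝ) = ULift.up 1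
    rw [hx]
    rfl
  have hEq : F = G := (h.existsUnique_extension realLine hReal (F.comp i)).unique rfl hFG
  have h1 : (ULift.up (f n : ℝ) : ULift.{u} ℝ) = ULift.up 1 :=
    congrArg (fun g : C(N.obj, realLine.{u}.obj) => g n) hEq
  rw [hfn] at h1
  exact zero_ne_one (congrArg ULift.down h1)

/-- Continuous maps to a power of the line extend to a functorial `P`-ification when `P`
contains the line. -/
theorem IsFunctorialPification.exists_extension_pi {P : ObjectProperty Tych.{u}}
    (hReal : P realLine) {X N : Tych.{u}} {i : C(X.obj, N.obj)}
    (h : IsFunctorialPification P X N i) {κ : Type*} {e : X.obj → κ → ℝ} (he : Continuous e) :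
    ∃ g : N.obj → κ → ℝ, Continuous g ∧ ∀ x, g (i x) = e x := by
  have key : ∀ k : κ, ∃ g : N.obj → ℝ, Continuous g ∧ ∀ x, g (i x) = e x k := by
    intro k
    let F : C(X.obj, realLine.{u}.obj) :=
      ⟨fun x => (ULift.up (e x k) : ULift.{u} ℝ),
        continuous_uliftUp.comp ((continuous_apply k).comp he)⟩
    obtain ⟨g, hg, -⟩ := h.existsUnique_extension realLine hReal F
    refine ⟨fun n => ULift.down (g n : ULift.{u} ℝ), continuous_uliftDown.comp g.continuous,
      fun x => ?_⟩
    exact (congrArg (fun f : C(X.obj, realLine.{u}.obj) => ULift.down (f x : ULift.{u} ℝ))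
      hg).symm
  choose g hg hgi using key
  exact ⟨fun n k => g k n, continuous_pi hg, fun x => funext fun k => hgi k x⟩

/-- A realcompact space is homeomorphic to each of its functorial `P`-ifications when `P`
contains the line. -/
theorem IsFunctorialPification.nonempty_homeomorph {P : ObjectProperty Tych.{u}}
    (hReal : P realLine) {X N : Tych.{u}} {i : C(X.obj, N.obj)}
    (h : IsFunctorialPification P X N i) (hX : RCpt X) : Nonempty (N.obj ≃ₜ X.obj) := by
  obtain ⟨κ, e, he⟩ := hX
  obtain ⟨g, hg, hgi⟩ := h.exists_extension_pi hReal he.continuous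
  have hdense := h.denseRange hReal
  have : T35Space N.obj := N.property
  have hmem : ∀ n, g n ∈ Set.range e := fun n =>
    hdense.induction_on n (he.isClosed_range.preimage hg) fun x => ⟨x, (hgi x).symm⟩
  choose r hr using hmem
  have hrc : Continuous r := by
    -- Continuity of `r` can be tested after composing with `e`, and `e ∘ r = g`.
    rw [he.isInducing.continuous_iff]
    exact hg.congr fun n => (hr n).symm
  have hri : ∀ x, r (i x) = x := fun x => he.injective ((hr _).trans (hgi x))
  -- Both sides agree on the dense image of `i`, and `N` is Hausdorff.
  have hir : i ∘ r = id := hdense.equalizer (i.continuous.comp hrc) continuous_id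
    (funext fun x => congrArg i (hri x))
  exact ⟨⟨⟨r, i, congrFun hir, hri⟩, hrc, i.continuous⟩⟩

/-- Every member of `P` is its own functorial `P`-ification. -/
theorem isFunctorialPification_id {P : ObjectProperty Tych.{u}} {X : Tych.{u}} (hX : P X) :
    IsFunctorialPification P X X (ContinuousMap.id X.obj) :=
  ⟨hX, fun _ _ f => ⟨f, rfl, fun _ hg => hg.symm⟩⟩

theorem mainTheorem10 (P : ObjectProperty Tych.{u}) [P.IsClosedUnderIsomorphisms]
    (hCpt : Cpt ≤ P) (hReal : P realLine) (hRCpt : P ≤ RCpt) :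
    FunctoriallyIfiable P ⊓ RCpt = P := by
  apply le_antisymm
  · rintro X ⟨⟨N, i, h⟩, hX⟩
    obtain ⟨φ⟩ := h.nonempty_homeomorph hReal hX
    exact P.prop_of_iso (ObjectProperty.isoMk _ (TopCat.isoOfHomeo φ)) h.mem
  · exact fun X hX => ⟨⟨X, _, isFunctorialPification_id hX⟩, hRCpt X hX⟩
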